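/- **Theorem 4.1.** Let $n\ge 1$ be an integer and let $b$ be a nonzero integer. There is a constant $C$, depending only on $n$ and $b$, such that for every integer $k\ge 0$ and every compact convex set $\Delta\subset\mathbb{R}^n$ of full dimension (i.e. with nonempty interior) whose diameter $\omega$ (the largest Euclidean distance between two of its points) satisfies $\omega\ge 1$, $$\left|\,|\Delta_b^k|-\left(\prod_{p^k\mid b}\left(1-\frac1{p^{kn}}\right)\right)\mathrm{vol}(\Delta)\right|\le C\,\omega^{n-1}.$$ Here $\Delta_b^k$ is the set of lattice points $x=(x_1,\dots,x_n)\in\Delta\cap\mathbb{Z}^n$ such that $p^k\nmid\gcd(x_1,\dots,x_n,b)$ for all primes $p$, and the product is over all distinct primes $p$ with $p^k\mid b$ (for $k=0$ every factor is $0$ and the product is $0$). -/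

import Mathlib

open MeasureTheory

/-- The integral points of a set `Δ ⊆ ℝⁿ`, as integer vectors. -/
def integralPoints {n : ℕ} (Δ : Set (EuclideanSpace ℝ (Fin n))) : Set (Fin n → ℤ) :=
  {x | WithLp.toLp 2 (fun i => (x i : ℝ)) ∈ Δ}

/-- `gcd(x, b) = gcd(x₁, …, xₙ, b)`, a natural number. -/
def latticeGcd {n : ℕ} (x : Fin n → ℤ) (b : ℤ) : ℕ :=
  Int.gcd (Finset.univ.gcd x) b

/-- The lattice point `x` is relatively `k`-free to `b`: no `p ^ k`, with `p` prime,
divides `gcd(x, b)`. -/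
def IsRelKFree {n : ℕ} (k : ℕ) (b : ℤ) (x : Fin n → ℤ) : Prop :=
  ∀ p : ℕ, p.Prime → ¬ p ^ k ∣ latticeGcd x b

/-- The integral points of `Δ` that are relatively `k`-free to `b`. -/
def relKFreePoints {n : ℕ} (k : ℕ) (b : ℤ) (Δ : Set (EuclideanSpace ℝ (Fin n))) :
    Set (Fin n → ℤ) :=
  {x ∈ integralPoints Δ | IsRelKFree k b x}

/-- The primes `p` with `p ^ k ∣ b`. -/
abbrev PrimePowDvd (k : ℕ) (b : ℤ) : Type :=
  {p : ℕ // p.Prime ∧ (p : ℤ) ^ k ∣ b}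

/-- The product of `1 - 1 / p ^ (k n)` over the distinct primes `p` with `p ^ k ∣ b`. For
`b ≠ 0` and `k ≥ 1` it is a finite product; for `k = 0` it runs over all primes and every
factor is `0`. -/
noncomputable def kFreeDensity (n k : ℕ) (b : ℤ) : ℝ :=
  ∏' p : PrimePowDvd k b, (1 - 1 / ((p : ℕ) : ℝ) ^ (k * n))

/-- The index set of the product is finite for `b ≠ 0` and `k ≥ 1`. -/
theorem finite_primePowDvd {k : ℕ} (hk : k ≠ 0) {b : ℤ} (hb : b ≠ 0) :
    Finite (PrimePowDvd k b) := by
  refine Set.Finite.to_subtype (s := {p : ℕ | p.Prime ∧ (p : ℤ) ^ k ∣ b})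
    ((b.natAbs.divisors.finite_toSet).subset ?_)
  rintro p ⟨-, hp⟩
  have h : (p : ℤ) ∣ b := (dvd_pow_self _ hk).trans hp
  simpa [hb] using Int.natCast_dvd.mp h

/-- The product converges, so that its value is never a default value. -/
theorem multipliable_kFreeDensity (n k : ℕ) {b : ℤ} (hb : b ≠ 0) :
    Multipliable fun p : PrimePowDvd k b => (1 - 1 / ((p : ℕ) : ℝ) ^ (k * n)) := by
  rcases eq_or_ne k 0 with rfl | hk
  · refine multipliable_of_exists_eq_zero ⟨⟨2, Nat.prime_two, by simp⟩, by simp⟩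
  · have := finite_primePowDvd hk hb
    have := Fintype.ofFinite (PrimePowDvd k b)
    exact (hasProd_fintype _).multipliable

/-- A bounded set has finitely many integral points, so that counting them is meaningful. -/
theorem finite_integralPoints {n : ℕ} {Δ : Set (EuclideanSpace ℝ (Fin n))}
    (h : Bornology.IsBounded Δ) : (integralPoints Δ).Finite := by
  obtain ⟨R, hR⟩ := h.exists_norm_le
  refine (Set.finite_Icc (fun _ : Fin n => -⌈R⌉) (fun _ => ⌈R⌉)).subset fun x hx => ?_
  have hb : ∀ i, |(x i : ℝ)| ≤ ⌈R⌉ := fun i => by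
    have h1 := (PiLp.norm_apply_le (WithLp.toLp 2 (fun i => (x i : ℝ)) :
      EuclideanSpace ℝ (Fin n)) i).trans (hR _ hx)
    rw [Real.norm_eq_abs] at h1
    exact h1.trans (Int.le_ceil R)
  exact ⟨fun i => by exact_mod_cast (abs_le.mp (hb i)).1,
    fun i => by exact_mod_cast (abs_le.mp (hb i)).2⟩

/-! Inclusion–exclusion over sets `T` of primes with `p ^ k ∣ b` reduces the count to points of
`mℤⁿ` in `Δ`, where `m = ∏ p ∈ T, p ^ k` (`ncard_relKFreePoints`). The density expands with the same
signs, so it suffices to compare each count with `vol(Δ) / m ^ n`; the number of sets `T` is bounded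
in terms of `b` alone.

Scaling by `1 / m` turns this into counting integer points of a compact convex set. Counting measure
is exchanged for Lebesgue measure one coordinate at a time (`pi_le_pi_add_of_convex`): by convexity
each line meets the set in an interval, where the two measures differ by at most 1, so an exchange
costs at most the measure of an `(n - 1)`-dimensional box, which is `O(ω ^ (n - 1))` uniformly in
`m`. -/

/-! ### Integers in an interval versus its length -/

/-- The measure on `ℝ` that counts integers. -/
noncomputable def integerCount : Measure ℝ :=
  Measure.map (fun z : ℤ => (z : ℝ)) Measure.count

theorem measurableEmbedding_intCast_real : MeasurableEmbedding (fun z : ℤ => (z : ℝ)) :=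
  Int.isClosedEmbedding_coe_real.measurableEmbedding

instance : SigmaFinite integerCount := measurableEmbedding_intCast_real.sigmaFinite_map

theorem integerCount_Icc (a b : ℝ) :
    integerCount (Set.Icc a b) = ((⌊b⌋ + 1 - ⌈a⌉).toNat : ENNReal) := by
  rw [integerCount, measurableEmbedding_intCast_real.map_apply]
  have : (fun z : ℤ => (z : ℝ)) ⁻¹' Set.Icc a b = (Finset.Icc ⌈a⌉ ⌊b⌋ : Finset ℤ) := by
    simp [Int.preimage_Icc]
  rw [this, Measure.count_apply_finset, Int.card_Icc]

theorem integerCount_Icc_le {a b : ℝ} (h : a ≤ b) :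
    integerCount (Set.Icc a b) ≤ ENNReal.ofReal (b - a) + 1 := by
  rw [integerCount_Icc, ← ENNReal.ofReal_natCast, ← ENNReal.ofReal_one,
    ← ENNReal.ofReal_add (by linarith) zero_le_one]
  apply ENNReal.ofReal_le_ofReal
  have h1 := Int.floor_le b
  have h2 := Int.le_ceil a
  rcases le_total 0 (⌊b⌋ + 1 - ⌈a⌉) with h0 | h0
  · have : (((⌊b⌋ + 1 - ⌈a⌉).toNat : ℤ) : ℝ) = ((⌊b⌋ + 1 - ⌈a⌉ : ℤ) : ℝ) := by
      rw [Int.toNat_of_nonneg h0]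
    push_cast at this
    linarith
  · rw [Int.toNat_of_nonpos h0]
    push_cast
    linarith

theorem le_integerCount_Icc_add_one (a b : ℝ) :
    ENNReal.ofReal (b - a) ≤ integerCount (Set.Icc a b) + 1 := by
  rw [integerCount_Icc, ← ENNReal.ofReal_natCast, ← ENNReal.ofReal_one,
    ← ENNReal.ofReal_add (by positivity) zero_le_one]
  apply ENNReal.ofReal_le_ofReal
  have h1 := Int.lt_floor_add_one b
  have h2 := Int.ceil_lt_add_one a
  have h3 : ((⌊b⌋ + 1 - ⌈a⌉ : ℤ) : ℝ) ≤ (((⌊b⌋ + 1 - ⌈a⌉).toNat : ℤ) : ℝ) := by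
    exact_mod_cast Int.self_le_toNat _
  push_cast at h3
  linarith

theorem exists_eq_Icc_of_convex_isCompact {I : Set ℝ} (hc : Convex ℝ I) (hI : IsCompact I)
    (hne : I.Nonempty) : ∃ a b, a ≤ b ∧ I = Set.Icc a b := by
  have h := eq_Icc_of_connected_compact ⟨hne, hc.isPreconnected⟩ hI
  refine ⟨sInf I, sSup I, ?_, h⟩
  rw [h] at hne
  exact Set.nonempty_Icc.mp hne

theorem integerCount_le_volume_add_one {I : Set ℝ} (hc : Convex ℝ I) (hI : IsCompact I) :
    integerCount I ≤ volume I + 1 := by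
  rcases I.eq_empty_or_nonempty with rfl | hne
  · simp
  obtain ⟨a, b, hab, rfl⟩ := exists_eq_Icc_of_convex_isCompact hc hI hne
  simpa using integerCount_Icc_le hab

theorem volume_le_integerCount_add_one {I : Set ℝ} (hc : Convex ℝ I) (hI : IsCompact I) :
    volume I ≤ integerCount I + 1 := by
  rcases I.eq_empty_or_nonempty with rfl | hne
  · simp
  obtain ⟨a, b, hab, rfl⟩ := exists_eq_Icc_of_convex_isCompact hc hI hne
  simpa using le_integerCount_Icc_add_one a b

/-! ### Exchanging counting for Lebesgue measure, coordinate by coordinate -/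

/-- Two product measures that differ in one coordinate only, where they differ by at most `1` on
compact intervals, differ on a compact convex set by at most the measure of its projection along
that coordinate. -/
theorem pi_le_pi_add_of_convex {m : ℕ} (i : Fin (m + 1)) (μ μ' : Fin (m + 1) → Measure ℝ)
    [∀ j, SigmaFinite (μ j)] [∀ j, SigmaFinite (μ' j)]
    (heq : ∀ j, μ (i.succAbove j) = μ' (i.succAbove j))
    (hle : ∀ I : Set ℝ, Convex ℝ I → IsCompact I → μ i I ≤ μ' i I + 1)
    {K : Set (Fin (m + 1) → ℝ)} (hc : Convex ℝ K) (hK : IsCompact K)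
    {B : Fin (m + 1) → Set ℝ} (hB : ∀ j, MeasurableSet (B j)) (hKB : K ⊆ Set.univ.pi B) :
    Measure.pi μ K ≤ Measure.pi μ' K + ∏ j, μ (i.succAbove j) (B (i.succAbove j)) := by
  set ρ := Measure.pi fun j => μ (i.succAbove j) with hρ
  have hρ' : (Measure.pi fun j => μ' (i.succAbove j)) = ρ := by
    rw [hρ]
    congr 1
    funext j
    exact (heq j).symm
  let e := MeasurableEquiv.piFinSuccAbove (fun _ : Fin (m + 1) => ℝ) i
  -- Tonelli along coordinate `i`; the remaining coordinates carry the common measure `ρ`.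
  have key : ∀ ν : Fin (m + 1) → Measure ℝ, (∀ j, SigmaFinite (ν j)) →
      (Measure.pi fun j => ν (i.succAbove j)) = ρ →
      Measure.pi ν K = ∫⁻ y, ν i {x | (i.insertNth x y : Fin (m + 1) → ℝ) ∈ K} ∂ρ := by
    intro ν hν hνρ
    have h1 := (measurePreserving_piFinSuccAbove ν i).symm
    rw [hνρ] at h1
    have : ∀ j, SigmaFinite (μ (i.succAbove j)) := inferInstance
    rw [← h1.measure_preimage_equiv, Measure.prod_apply_symm]
    · rfl
    · exact e.symm.measurable hK.measurableSet
  rw [key μ inferInstance rfl, key μ' inferInstance hρ']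
  let A : Set (Fin m → ℝ) := Set.univ.pi fun j => B (i.succAbove j)
  have hA : MeasurableSet A := MeasurableSet.univ_pi fun j => hB _
  calc ∫⁻ y, μ i {x | (i.insertNth x y : Fin (m + 1) → ℝ) ∈ K} ∂ρ
      ≤ ∫⁻ y, (μ' i {x | (i.insertNth x y : Fin (m + 1) → ℝ) ∈ K} + A.indicator 1 y) ∂ρ := by
        refine lintegral_mono fun y => ?_
        -- A section is the projection of a slice of `K` by a closed affine line, hence compact and
        -- convex.
        have hsec : {x | (i.insertNth x y : Fin (m + 1) → ℝ) ∈ K} =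
            (fun z : Fin (m + 1) → ℝ => z i) '' (K ∩ {z | ∀ j, z (i.succAbove j) = y j}) := by
          ext x
          constructor
          · intro hx
            exact ⟨_, ⟨hx, fun j => by simp⟩, by simp⟩
          · rintro ⟨z, ⟨hz, hzy⟩, rfl⟩
            have : (i.insertNth (z i) y : Fin (m + 1) → ℝ) = z := by
              rw [Fin.insertNth_eq_iff]
              exact ⟨rfl, funext fun j => (hzy j).symm⟩
            simpa [this] using hz
        -- Sections over points outside `A` are empty, so the error 1 is paid only on `A`.
        by_cases hy : y ∈ A
        · simp only [hy, Set.indicator_of_mem, Pi.one_apply]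
          refine hle _ ?_ ?_
          · rw [hsec]
            refine Convex.is_linear_image (hc.inter ?_) ⟨fun _ _ => rfl, fun _ _ => rfl⟩
            intro z hz w hw s t _ _ hst j
            simp only [Set.mem_ofPred_eq] at hz hw
            simp only [Pi.add_apply, Pi.smul_apply, hz j, hw j, smul_eq_mul]
            rw [← add_mul, hst, one_mul]
          · rw [hsec]
            refine (hK.inter_right ?_).image (continuous_apply i)
            simp only [Set.ofPred_forall]
            exact isClosed_iInter fun j => isClosed_eq (continuous_apply _) continuous_const
        · have : {x | (i.insertNth x y : Fin (m + 1) → ℝ) ∈ K} = ∅ := by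
            rw [Set.eq_empty_iff_forall_notMem]
            intro x hx
            refine hy fun j _ => ?_
            simpa using hKB hx (i.succAbove j) trivial
          simp [this]
    _ = _ := by
        rw [lintegral_add_right _ (measurable_one.indicator hA), lintegral_indicator_one hA, hρ,
          Measure.pi_pi]

/-- Lebesgue measure in the coordinates below `j`, integer counting in the others. -/
noncomputable def hybridMeasure {n : ℕ} (j : ℕ) (i : Fin n) : Measure ℝ :=
  if (i : ℕ) < j then volume else integerCount

instance {n : ℕ} (j : ℕ) (i : Fin n) : SigmaFinite (hybridMeasure j i) := by
  unfold hybridMeasure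
  split_ifs <;> infer_instance

theorem hybridMeasure_Icc_le {n : ℕ} (j : ℕ) (i : Fin n) {a b : ℝ} (h : a ≤ b) :
    hybridMeasure j i (Set.Icc a b) ≤ ENNReal.ofReal (b - a) + 1 := by
  unfold hybridMeasure
  split_ifs
  · simp
  · exact integerCount_Icc_le h

theorem hybridMeasure_succ_of_ne {n : ℕ} {j : ℕ} {i : Fin n} (h : (i : ℕ) ≠ j) :
    hybridMeasure (j + 1) i = hybridMeasure j i := by
  unfold hybridMeasure
  congr 1
  simp only [eq_iff_iff]
  omega

theorem pi_hybridMeasure_succ {m : ℕ} {j : ℕ} (hj : j < m + 1) {K : Set (Fin (m + 1) → ℝ)}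
    (hc : Convex ℝ K) (hK : IsCompact K) {c : Fin (m + 1) → ℝ} {r : ℝ} (hr : 0 ≤ r)
    (hKB : K ⊆ Set.univ.pi fun i => Set.Icc (c i - r) (c i + r)) :
    Measure.pi (hybridMeasure (j + 1)) K ≤
        Measure.pi (hybridMeasure j) K + ENNReal.ofReal ((2 * r + 1) ^ m) ∧
      Measure.pi (hybridMeasure j) K ≤
        Measure.pi (hybridMeasure (j + 1)) K + ENNReal.ofReal ((2 * r + 1) ^ m) := by
  have hne : ∀ l : Fin m, (((⟨j, hj⟩ : Fin (m + 1)).succAbove l : Fin (m + 1)) : ℕ) ≠ j :=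
    fun l h => Fin.succAbove_ne ⟨j, hj⟩ l (Fin.ext h)
  have hbox : ∀ k : ℕ, ∏ l : Fin m, hybridMeasure k ((⟨j, hj⟩ : Fin (m + 1)).succAbove l)
      (Set.Icc (c ((⟨j, hj⟩ : Fin (m + 1)).succAbove l) - r)
        (c ((⟨j, hj⟩ : Fin (m + 1)).succAbove l) + r)) ≤ ENNReal.ofReal ((2 * r + 1) ^ m) := by
    intro k
    rw [ENNReal.ofReal_pow (by positivity)]
    refine (Finset.prod_le_pow_card _ _ (ENNReal.ofReal (2 * r + 1)) fun l _ => ?_).trans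
      (by simp)
    refine (hybridMeasure_Icc_le _ _ (by linarith)).trans_eq ?_
    rw [ENNReal.ofReal_add (by positivity) zero_le_one, ENNReal.ofReal_one]
    ring_nf
  constructor
  · refine (pi_le_pi_add_of_convex ⟨j, hj⟩ (hybridMeasure (j + 1)) (hybridMeasure j)
      (fun l => hybridMeasure_succ_of_ne (hne l)) (fun I h1 h2 => ?_) hc hK
      (fun _ => measurableSet_Icc) hKB).trans (add_le_add_right (hbox _) _)
    simpa [hybridMeasure] using volume_le_integerCount_add_one h1 h2
  · refine (pi_le_pi_add_of_convex ⟨j, hj⟩ (hybridMeasure j) (hybridMeasure (j + 1))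
      (fun l => (hybridMeasure_succ_of_ne (hne l)).symm) (fun I h1 h2 => ?_) hc hK
      (fun _ => measurableSet_Icc) hKB).trans (add_le_add_right (hbox _) _)
    simpa [hybridMeasure] using integerCount_le_volume_add_one h1 h2

theorem pi_hybridMeasure_zero_apply {n : ℕ} {K : Set (Fin n → ℝ)} (hK : MeasurableSet K) :
    Measure.pi (hybridMeasure (n := n) 0) K =
      ({x : Fin n → ℤ | (fun i => (x i : ℝ)) ∈ K}.encard : ENNReal) := by
  have h0 : (hybridMeasure (n := n) 0) =
      fun _ => Measure.map (fun z : ℤ => (z : ℝ)) Measure.count := by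
    funext i
    simp [hybridMeasure, integerCount]
  have hcount : Measure.pi (fun _ : Fin n => (Measure.count : Measure ℤ)) = Measure.count := by
    refine Measure.ext_of_singleton fun x => ?_
    rw [Measure.pi_singleton]
    simp
  have hmeas : Measurable fun (x : Fin n → ℤ) (i : Fin n) => (x i : ℝ) := by fun_prop
  have hmap := Measure.pi_map_pi (ι := Fin n) (X := fun _ => ℤ) (Y := fun _ => ℝ)
    (μ := fun _ => Measure.count) (f := fun _ z => (z : ℝ))
    (hμ := fun _ => measurableEmbedding_intCast_real.sigmaFinite_map)
    (fun _ => measurableEmbedding_intCast_real.measurable.aemeasurable)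
  rw [h0, ← hmap, hcount, Measure.map_apply hmeas hK, Measure.count_apply (hmeas hK)]
  rfl

/-- Telescopes the `m + 1` exchanges between counting (index `0`) and Lebesgue measure (index `m +
1`). -/
theorem abs_ncard_sub_volume_le {m : ℕ} {K : Set (Fin (m + 1) → ℝ)}
    (hc : Convex ℝ K) (hK : IsCompact K) {c : Fin (m + 1) → ℝ} {r : ℝ} (hr : 0 ≤ r)
    (hKB : K ⊆ Set.univ.pi fun i => Set.Icc (c i - r) (c i + r)) :
    |(({x : Fin (m + 1) → ℤ | (fun i => (x i : ℝ)) ∈ K}.ncard : ℝ)) - (volume K).toReal| ≤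
      (m + 1) * (2 * r + 1) ^ m := by
  have hstep : ∀ j ≤ m + 1,
      Measure.pi (hybridMeasure j) K ≤
          Measure.pi (hybridMeasure 0) K + ENNReal.ofReal (j * (2 * r + 1) ^ m) ∧
        Measure.pi (hybridMeasure 0) K ≤
          Measure.pi (hybridMeasure j) K + ENNReal.ofReal (j * (2 * r + 1) ^ m) := by
    intro j
    induction j with
    | zero => simp
    | succ j ih =>
      intro hj
      obtain ⟨h1, h2⟩ := ih (by omega)
      obtain ⟨h3, h4⟩ := pi_hybridMeasure_succ (j := j) (by omega) hc hK hr hKB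
      have e : ENNReal.ofReal ((j + 1 : ℕ) * (2 * r + 1) ^ m) =
          ENNReal.ofReal (j * (2 * r + 1) ^ m) + ENNReal.ofReal ((2 * r + 1) ^ m) := by
        rw [← ENNReal.ofReal_add (by positivity) (by positivity)]
        push_cast
        ring_nf
      rw [e]
      constructor
      · exact h3.trans ((add_le_add_left h1 _).trans_eq (by ring))
      · exact h2.trans ((add_le_add_left h4 _).trans_eq (by ring))
  obtain ⟨h1, h2⟩ := hstep (m + 1) le_rfl
  have hvol : Measure.pi (hybridMeasure (n := m + 1) (m + 1)) = volume := by
    rw [volume_pi]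
    congr 1
    funext i
    simp only [hybridMeasure, i.2, if_true]
  rw [hvol, pi_hybridMeasure_zero_apply hK.measurableSet] at h1 h2
  -- An infinite set would have `ncard` equal to `0`; the bound `h2` by a finite volume excludes
  -- this.
  have hfin : {x : Fin (m + 1) → ℤ | (fun i => (x i : ℝ)) ∈ K}.Finite := by
    by_contra hinf
    rw [Set.Infinite.encard_eq hinf] at h2
    have := hK.measure_lt_top (μ := volume)
    simp [this.ne] at h2
  rw [← hfin.cast_ncard_eq] at h1 h2
  have hp : (0 : ℝ) ≤ (m + 1) * (2 * r + 1) ^ m := by positivity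
  have hv := hK.measure_lt_top (μ := volume)
  have h1' := ENNReal.toReal_mono (by simp) h1
  have h2' := ENNReal.toReal_mono (by simp [hv.ne]) h2
  rw [ENNReal.toReal_add (by simp) (by simp), ENNReal.toReal_ofReal (by push_cast; positivity)]
    at h1'
  rw [ENNReal.toReal_add hv.ne (by simp), ENNReal.toReal_ofReal (by push_cast; positivity)] at h2'
  simp at h1' h2'
  rw [abs_le]
  constructor <;> linarith

/-! ### Points of a scaled lattice -/

open scoped Pointwise in
/-- The number of points of `mℤⁿ` in a compact convex set. -/
theorem abs_ncard_dvd_sub_volume_le {n : ℕ} {Δ : Set (EuclideanSpace ℝ (Fin (n + 1)))}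
    (hc : Convex ℝ Δ) (hΔ : IsCompact Δ) (hne : Δ.Nonempty) (hd : 1 ≤ Metric.diam Δ)
    {m : ℕ} (hm : m ≠ 0) :
    |(({x ∈ integralPoints Δ | ∀ i, (m : ℤ) ∣ x i}.ncard : ℝ)) -
        1 / (m : ℝ) ^ (n + 1) * (volume Δ).toReal| ≤
      (n + 1) * 3 ^ n * Metric.diam Δ ^ n := by
  obtain ⟨c, hcΔ⟩ := hne
  have hm1 : (1 : ℝ) ≤ m := by exact_mod_cast Nat.one_le_iff_ne_zero.mpr hm
  have hm0 : (m : ℝ) ≠ 0 := by positivity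
  let K₀ : Set (Fin (n + 1) → ℝ) := WithLp.toLp 2 ⁻¹' Δ
  have hK₀ : K₀ = WithLp.ofLp '' Δ := by
    ext x
    exact ⟨fun h => ⟨_, h, rfl⟩, by rintro ⟨y, hy, rfl⟩; exact hy⟩
  let K : Set (Fin (n + 1) → ℝ) := (m : ℝ)⁻¹ • K₀
  have hK₀c : Convex ℝ K₀ := by
    rw [hK₀]
    exact hc.is_linear_image ⟨fun _ _ => rfl, fun _ _ => rfl⟩
  have hK₀k : IsCompact K₀ := by
    rw [hK₀]
    exact hΔ.image (PiLp.continuous_ofLp 2 _)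
  have hvol : volume K₀ = volume Δ :=
    (PiLp.volume_preserving_toLp (Fin (n + 1))).measure_preimage
      hΔ.measurableSet.nullMeasurableSet
  have hmem : ∀ x : Fin (n + 1) → ℝ, x ∈ K ↔ WithLp.toLp 2 ((m : ℝ) • x) ∈ Δ := by
    intro x
    rw [Set.mem_inv_smul_set_iff₀ hm0]
    rfl
  -- The half-side is `diam Δ` rather than `diam Δ / m`: weaker, but it makes the error independent
  -- of `m`.
  have hbox : K ⊆ Set.univ.pi fun i =>
      Set.Icc ((m : ℝ)⁻¹ * c i - Metric.diam Δ) ((m : ℝ)⁻¹ * c i + Metric.diam Δ) := by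
    intro x hx i _
    have h1 := Metric.dist_le_diam_of_mem hΔ.isBounded ((hmem x).mp hx) hcΔ
    rw [dist_eq_norm] at h1
    have h2 := (PiLp.norm_apply_le (WithLp.toLp 2 ((m : ℝ) • x) - c) i).trans h1
    have h3 : (WithLp.toLp 2 ((m : ℝ) • x) - c) i = m * (x i - (m : ℝ)⁻¹ * c i) := by
      simp only [PiLp.sub_apply, Pi.smul_apply, smul_eq_mul]
      field_simp
    rw [h3, Real.norm_eq_abs, abs_mul, abs_of_pos (by positivity)] at h2
    have h4 : |x i - (m : ℝ)⁻¹ * c i| ≤ Metric.diam Δ :=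
      (le_mul_of_one_le_left (abs_nonneg _) hm1).trans h2
    rw [abs_le] at h4
    constructor <;> linarith
  have key := abs_ncard_sub_volume_le (hK₀c.smul (m : ℝ)⁻¹) (hK₀k.smul (m : ℝ)⁻¹)
    (zero_le_one.trans hd) hbox
  have hvolK : (volume ((m : ℝ)⁻¹ • K₀)).toReal = 1 / (m : ℝ) ^ (n + 1) * (volume Δ).toReal := by
    rw [Measure.addHaar_smul, hvol, ENNReal.toReal_mul, ENNReal.toReal_ofReal (abs_nonneg _),
      abs_of_pos (by positivity)]
    simp
  have hcard : {x ∈ integralPoints Δ | ∀ i, (m : ℤ) ∣ x i}.ncard =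
      {x : Fin (n + 1) → ℤ | (fun i => (x i : ℝ)) ∈ K}.ncard := by
    have himage : {x ∈ integralPoints Δ | ∀ i, (m : ℤ) ∣ x i} =
        (fun (x : Fin (n + 1) → ℤ) i => (m : ℤ) * x i) ''
          {x : Fin (n + 1) → ℤ | (fun i => (x i : ℝ)) ∈ K} := by
      ext x
      constructor
      · rintro ⟨hx, hdvd⟩
        choose y hy using hdvd
        obtain rfl : x = fun i => (m : ℤ) * y i := funext hy
        refine ⟨y, ?_, rfl⟩
        change _ ∈ K
        rw [hmem]
        simpa [integralPoints, Pi.smul_def] using hx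
      · rintro ⟨y, hy, rfl⟩
        refine ⟨?_, fun i => dvd_mul_right _ _⟩
        change _ ∈ K at hy
        rw [hmem] at hy
        simpa [integralPoints, Pi.smul_def] using hy
    rw [himage, Set.ncard_image_of_injective]
    intro x y hxy
    funext i
    exact mul_left_cancel₀ (by exact_mod_cast hm) (congrFun hxy i)
  rw [hcard, ← hvolK]
  refine key.trans ?_
  -- The factor 3 comes from `2ω + 1 ≤ 3ω`, valid since `ω ≥ 1`.
  rw [mul_assoc, ← mul_pow]
  gcongr
  linarith

/-! ### Inclusion–exclusion over primes -/

/-- The primes `p` with `p ^ k ∣ b`, when `b ≠ 0` and `k ≠ 0`. -/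
def primesPowDvd (k : ℕ) (b : ℤ) : Finset ℕ :=
  b.natAbs.divisors.filter fun p => p.Prime ∧ p ^ k ∣ b.natAbs

theorem mem_primesPowDvd {k : ℕ} (hk : k ≠ 0) {b : ℤ} (hb : b ≠ 0) {p : ℕ} :
    p ∈ primesPowDvd k b ↔ p.Prime ∧ p ^ k ∣ b.natAbs := by
  simp only [primesPowDvd, Finset.mem_filter, Nat.mem_divisors, and_iff_right_iff_imp]
  exact fun h => ⟨(dvd_pow_self p hk).trans h.2, by simpa using hb⟩

theorem kFreeDensity_eq_prod (n : ℕ) {k : ℕ} (hk : k ≠ 0) {b : ℤ} (hb : b ≠ 0) :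
    kFreeDensity n k b = ∏ p ∈ primesPowDvd k b, (1 - 1 / (p : ℝ) ^ (k * n)) := by
  rw [← Finset.tprod_subtype, kFreeDensity]
  have h : ∀ p : ℕ, (p.Prime ∧ (p : ℤ) ^ k ∣ b) ↔ p ∈ primesPowDvd k b := fun p => by
    rw [mem_primesPowDvd hk hb, ← Nat.cast_pow, Int.natCast_dvd]
  exact (Equiv.subtypeEquivRight h).tprod_eq
    fun p : {p // p ∈ primesPowDvd k b} => (1 - 1 / ((p : ℕ) : ℝ) ^ (k * n))

theorem dvd_latticeGcd_iff {n : ℕ} (x : Fin n → ℤ) (b : ℤ) (d : ℕ) :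
    d ∣ latticeGcd x b ↔ (∀ i, (d : ℤ) ∣ x i) ∧ d ∣ b.natAbs := by
  rw [latticeGcd, ← Int.natCast_dvd_natCast, Int.dvd_coe_gcd_iff, Finset.dvd_gcd_iff,
    Int.natCast_dvd (n := b)]
  simp

theorem isRelKFree_iff {n k : ℕ} (hk : k ≠ 0) {b : ℤ} (hb : b ≠ 0) (x : Fin n → ℤ) :
    IsRelKFree k b x ↔ ∀ p ∈ primesPowDvd k b, ¬ ∀ i, ((p ^ k : ℕ) : ℤ) ∣ x i := by
  simp only [IsRelKFree, dvd_latticeGcd_iff, mem_primesPowDvd hk hb]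
  grind

/-- Powers of distinct primes are coprime, so the divisibility conditions merge into a single
modulus. -/
theorem forall_pow_dvd_iff_prod_dvd {n k : ℕ} {T : Finset ℕ} (hT : ∀ p ∈ T, p.Prime)
    (x : Fin n → ℤ) :
    (∀ p ∈ T, ∀ i, ((p ^ k : ℕ) : ℤ) ∣ x i) ↔ ∀ i, ((∏ p ∈ T, p ^ k : ℕ) : ℤ) ∣ x i := by
  constructor
  · intro h i
    rw [Nat.cast_prod]
    refine Finset.prod_dvd_of_coprime (fun p hp q hq hpq => ?_) fun p hp => h p hp i
    rw [Function.onFun, Nat.isCoprime_iff_coprime]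
    exact Nat.Coprime.pow _ _ ((Nat.coprime_primes (hT p hp) (hT q hq)).mpr hpq)
  · intro h p hp i
    exact (Int.natCast_dvd_natCast.mpr (Finset.dvd_prod_of_mem (fun p => p ^ k) hp)).trans (h i)

open Classical in
theorem ncard_relKFreePoints {n k : ℕ} (hk : k ≠ 0) {b : ℤ} (hb : b ≠ 0)
    {Δ : Set (EuclideanSpace ℝ (Fin n))} (hΔ : Bornology.IsBounded Δ) :
    ((relKFreePoints k b Δ).ncard : ℝ) = ∑ T ∈ (primesPowDvd k b).powerset, (-1) ^ T.card *
      ({x ∈ integralPoints Δ | ∀ i, ((∏ p ∈ T, p ^ k : ℕ) : ℤ) ∣ x i}.ncard : ℝ) := by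
  have hcount : ∀ P : (Fin n → ℤ) → Prop, ({x ∈ integralPoints Δ | P x}.ncard : ℝ) =
      ∑ x ∈ (finite_integralPoints hΔ).toFinset, if P x then 1 else 0 := by
    intro P
    rw [Finset.sum_boole, ← Set.ncard_coe_finset]
    simp
  rw [relKFreePoints, hcount]
  simp only [hcount, Finset.mul_sum]
  rw [Finset.sum_comm]
  refine Finset.sum_congr rfl fun x _ => ?_
  -- The indicator of being relatively `k`-free is a product over primes; expanding it gives the
  -- signed sum over `T`.
  have hprod : (if IsRelKFree k b x then (1 : ℝ) else 0) =
      ∏ p ∈ primesPowDvd k b, (1 - if ∀ i, ((p ^ k : ℕ) : ℤ) ∣ x i then (1 : ℝ) else 0) := by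
    rw [isRelKFree_iff hk hb]
    split_ifs with h
    · exact (Finset.prod_eq_one fun p hp => by rw [if_neg (h p hp), sub_zero]).symm
    · push Not at h
      obtain ⟨p, hp, hpx⟩ := h
      exact (Finset.prod_eq_zero hp (by rw [if_pos hpx, sub_self])).symm
  rw [hprod, Finset.prod_sub]
  refine Finset.sum_congr rfl fun T hT => ?_
  rw [Finset.prod_const_one, mul_one, Finset.prod_boole]
  congr 2
  exact propext (forall_pow_dvd_iff_prod_dvd
    (fun p hp => ((mem_primesPowDvd hk hb).mp (Finset.mem_powerset.mp hT hp)).1) x)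

theorem kFreeDensity_eq_sum (n : ℕ) {k : ℕ} (hk : k ≠ 0) {b : ℤ} (hb : b ≠ 0) :
    kFreeDensity n k b = ∑ T ∈ (primesPowDvd k b).powerset, (-1) ^ T.card *
      (1 / ((∏ p ∈ T, p ^ k : ℕ) : ℝ) ^ n) := by
  rw [kFreeDensity_eq_prod n hk hb, Finset.prod_sub]
  refine Finset.sum_congr rfl fun T _ => ?_
  rw [Finset.prod_const_one, mul_one]
  simp [pow_mul, Finset.prod_pow]

theorem theorem4p1 (n : ℕ) (hn : 1 ≤ n) (b : ℤ) (hb : b ≠ 0) :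
    ∃ C : ℝ, ∀ (k : ℕ) (Δ : Set (EuclideanSpace ℝ (Fin n))),
      Convex ℝ Δ → IsCompact Δ → (interior Δ).Nonempty → 1 ≤ Metric.diam Δ →
        |((relKFreePoints k b Δ).ncard : ℝ) - kFreeDensity n k b * (volume Δ).toReal| ≤
          C * Metric.diam Δ ^ (n - 1) := by
  obtain ⟨n, rfl⟩ : ∃ m, n = m + 1 := ⟨n - 1, by omega⟩
  -- For every `k ≠ 0` the relevant primes are divisors of `b`, so the power of 2 bounds the number
  -- of sets `T` independently of `k`.
  refine ⟨2 ^ b.natAbs.divisors.card * ((n + 1) * 3 ^ n), fun k Δ hc hΔ hint hd => ?_⟩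
  rw [Nat.add_sub_cancel]
  -- For `k = 0`, `p ^ 0 = 1` divides everything, so no point qualifies and the density has a zero
  -- factor. `primesPowDvd` does not describe this case, as it keeps only divisors of `b`.
  rcases eq_or_ne k 0 with rfl | hk
  · have h1 : relKFreePoints 0 b Δ = ∅ :=
      Set.eq_empty_of_forall_notMem fun x hx => hx.2 2 Nat.prime_two (by simp)
    have h2 : kFreeDensity (n + 1) 0 b = 0 :=
      tprod_of_exists_eq_zero ⟨⟨2, Nat.prime_two, by simp⟩, by simp⟩
    rw [h1, h2]
    simp only [Set.ncard_empty, Nat.cast_zero, zero_mul, sub_zero, abs_zero]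
    positivity
  · rw [ncard_relKFreePoints hk hb hΔ.isBounded, kFreeDensity_eq_sum (n + 1) hk hb,
      Finset.sum_mul, ← Finset.sum_sub_distrib]
    refine (Finset.abs_sum_le_sum_abs _ _).trans ?_
    refine (Finset.sum_le_card_nsmul _ _ ((n + 1) * 3 ^ n * Metric.diam Δ ^ n)
      fun T hT => ?_).trans ?_
    · rw [mul_assoc, ← mul_sub, abs_mul, abs_pow, abs_neg, abs_one, one_pow, one_mul]
      refine abs_ncard_dvd_sub_volume_le hc hΔ (hint.mono interior_subset) hd
        (Finset.prod_ne_zero_iff.mpr fun p hp => pow_ne_zero _ ?_)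
      exact ((mem_primesPowDvd hk hb).mp (Finset.mem_powerset.mp hT hp)).1.ne_zero
    · rw [Finset.card_powerset, nsmul_eq_mul, ← mul_assoc]
      push_cast
      gcongr
      · exact one_le_two
      · exact Finset.filter_subset _ _
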